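/- Let $K$ be a field and let $Q$ be a finite quiver (finitely many vertices and arrows; loops, multiple arrows and oriented cycles are allowed). Let $KQ$ be its path algebra, where the product $pq$ of paths is "first $p$, then $q$", and let $C\subseteq KQ$ be the two-sided ideal generated by all differences $p-q$ of parallel paths (paths with the same start and the same end, paths of length zero included). The algebra $KQ/C$ is called the commuting algebra of $KQ$; let $\rho\colon KQ\to KQ/C$ be the canonical surjection. Call two vertices $v,w$ of $Q$ equivalent if there are paths from $v$ to $w$ and from $w$ to $v$, and let $D_1,\dots,D_m$ be the equivalence classes (the path connected components). Choose a vertex $w_i\in D_i$ for each $i$, let $P=\bigoplus_{i=1}^m\rho(w_i)\,KQ/C$ (a right $KQ/C$-module), and let $Sk(Q)=\operatorname{End}_{KQ/C}(P)$ be the skeleton of $KQ$. The vertices of $Sk(Q)$ are $x_1,\dots,x_m$, one for each component, partially ordered by: $x_i\le x_j$ if and only if there is a path in $Q$ from $w_i$ to $w_j$. A chain $x_{i_1}<x_{i_2}<\dots<x_{i_t}$ is said to have length $t$ (the number of its elements). Theorem. For every choice of the vertices $w_i$, both $KQ/C$ and $Sk(Q)$ are finite dimensional $K$-algebras. Moreover,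 if $t$ denotes the length of the longest chain in the poset $\{x_1,\dots,x_m\}$, then $t$ is finite, and the global dimensions of $KQ/C$ and of $Sk(Q)$ (both the right and the left global dimension, that is, the supremum of the projective dimensions of all right, respectively left, modules) are at most $t$; in particular they are finite. -/

import Mathlib

open CategoryTheory

universe u v w

noncomputable section

namespace Quiver

/-- The set of all paths of the quiver `V` (paths of length zero, i.e. vertices, included),
each remembered together with its start and its end. -/
abbrev AllPaths (V : Type u) [Quiver.{v} V] : Type max u v :=
  Σ a : V, Σ b : V, Path a b

/-- The path algebra `KQ`: the `K`-vector space with basis the set of all paths. -/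
def PathAlgebra (K : Type w) (V : Type u) [Field K] [Quiver.{v} V] : Type max u v w :=
  AllPaths V →₀ K

namespace PathAlgebra

variable (K : Type w) {V : Type u} [Field K] [Quiver.{v} V]

instance : AddCommGroup (PathAlgebra K V) := inferInstanceAs (AddCommGroup (AllPaths V →₀ K))

instance : Module K (PathAlgebra K V) := inferInstanceAs (Module K (AllPaths V →₀ K))

/-- The basis of `KQ` given by the paths. -/
def basis : Module.Basis (AllPaths V) K (PathAlgebra K V) := Finsupp.basisSingleOne

/-- A path, as an element of the path algebra. -/
def ofPath {a b : V} (p : Path a b) : PathAlgebra K V := basis K ⟨a, b, p⟩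

open Classical in
/-- The product of two basis elements: the concatenation `p q` (first `p`, then `q`) if `p` ends
where `q` starts, and `0` otherwise. -/
def pathMul : AllPaths V → AllPaths V → PathAlgebra K V
  | ⟨_, b, p⟩, ⟨b', _, q⟩ => if h : b = b' then ofPath K (p.comp (h ▸ q)) else 0

/-- The multiplication of `KQ`: the bilinear extension of the product of paths. -/
def mulHom : PathAlgebra K V →ₗ[K] PathAlgebra K V →ₗ[K] PathAlgebra K V :=
  (basis K).constr K fun p => (basis K).constr K fun q => pathMul K p q

instance : Mul (PathAlgebra K V) := ⟨fun x y => mulHom K x y⟩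

theorem mul_def (x y : PathAlgebra K V) : x * y = mulHom K x y := rfl

theorem ofPath_mul {a b c : V} (p : Path a b) (q : Path b c) :
    ofPath K p * ofPath K q = ofPath K (p.comp q) := by
  simp [mul_def, mulHom, ofPath, pathMul]

theorem ofPath_mul_of_ne {a b b' c : V} (h : b ≠ b') (p : Path a b) (q : Path b' c) :
    ofPath K p * ofPath K q = 0 := by
  simp [mul_def, mulHom, ofPath, pathMul, h]

theorem hom_ext {M : Type*} [AddCommGroup M] [Module K M] {f g : PathAlgebra K V →ₗ[K] M}
    (h : ∀ (a b : V) (p : Path a b), f (ofPath K p) = g (ofPath K p)) : f = g :=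
  (basis K).ext fun ⟨a, b, p⟩ => h a b p

theorem assoc (x y z : PathAlgebra K V) : x * y * z = x * (y * z) := by
  let L : PathAlgebra K V →ₗ[K] PathAlgebra K V →ₗ[K] PathAlgebra K V →ₗ[K] PathAlgebra K V :=
    (mulHom K).compr₂ (mulHom K)
  let R : PathAlgebra K V →ₗ[K] PathAlgebra K V →ₗ[K] PathAlgebra K V →ₗ[K] PathAlgebra K V :=
    LinearMap.mk₂ K (fun x y => mulHom K x ∘ₗ mulHom K y)
      (by intros; ext; simp) (by intros; ext; simp) (by intros; ext; simp) (by intros; ext; simp)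
  have hLR : L = R := by
    refine hom_ext K fun a b p => hom_ext K fun b' c q => hom_ext K fun c' d r => ?_
    change ofPath K p * ofPath K q * ofPath K r = ofPath K p * (ofPath K q * ofPath K r)
    by_cases h1 : b = b' <;> by_cases h2 : c = c'
    · subst h1 h2; simp [ofPath_mul, Path.comp_assoc]
    · subst h1; rw [ofPath_mul, ofPath_mul_of_ne K h2, ofPath_mul_of_ne K h2]; simp [mul_def]
    · subst h2; rw [ofPath_mul, ofPath_mul_of_ne K h1, ofPath_mul_of_ne K h1]; simp [mul_def]
    · rw [ofPath_mul_of_ne K h1, ofPath_mul_of_ne K h2]; simp [mul_def]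
  exact congrArg (fun f => f x y z) hLR

variable [Fintype V]

/-- The unit of `KQ`: the sum of all vertices. -/
instance : One (PathAlgebra K V) := ⟨∑ a : V, ofPath K (Path.nil : Path a a)⟩

theorem one_def : (1 : PathAlgebra K V) = ∑ a : V, ofPath K (Path.nil : Path a a) := rfl

theorem unit_mul (x : PathAlgebra K V) : 1 * x = x := by
  have : mulHom K (1 : PathAlgebra K V) = LinearMap.id := by
    refine hom_ext K fun a b p => ?_
    rw [one_def, map_sum, LinearMap.sum_apply, Finset.sum_eq_single a]
    · rw [← mul_def, ofPath_mul, Path.nil_comp, LinearMap.id_apply]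
    · intro c _ hc
      exact ofPath_mul_of_ne K hc _ _
    · simp
  exact congrArg (fun f => f x) this

theorem mul_unit (x : PathAlgebra K V) : x * 1 = x := by
  have : ∑ a : V, (mulHom K).flip (ofPath K (Path.nil : Path a a)) = LinearMap.id := by
    refine hom_ext K fun a b p => ?_
    rw [LinearMap.sum_apply, Finset.sum_eq_single b]
    · rw [LinearMap.flip_apply, ← mul_def, ofPath_mul, Path.comp_nil, LinearMap.id_apply]
    · intro c _ hc
      rw [LinearMap.flip_apply, ← mul_def, ofPath_mul_of_ne K hc.symm]
    · simp
  rw [mul_def, one_def, map_sum]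
  simpa using congrArg (fun f => f x) this

instance : Ring (PathAlgebra K V) :=
  { (inferInstance : AddCommGroup (PathAlgebra K V)) with
    mul := (· * ·)
    one := 1
    left_distrib := fun x y z => by simp [mul_def]
    right_distrib := fun x y z => by simp [mul_def]
    zero_mul := fun x => by simp [mul_def]
    mul_zero := fun x => by simp [mul_def]
    mul_assoc := assoc K
    one_mul := unit_mul K
    mul_one := mul_unit K }

instance : Algebra K (PathAlgebra K V) :=
  Algebra.ofModule (fun r x y => (mulHom K).map_smul₂ r x y)
    (fun r x y => (mulHom K x).map_smul r y)

end PathAlgebra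

section Commuting

variable (K : Type w) (V : Type u) [Field K] [Quiver.{v} V] [Fintype V]

/-- The commuting ideal `C` of `KQ`: the two-sided ideal generated by all differences `p - q` of
parallel paths. -/
def commutingIdeal : TwoSidedIdeal (PathAlgebra K V) :=
  TwoSidedIdeal.span {x | ∃ (a b : V) (p q : Path a b),
    x = PathAlgebra.ofPath K p - PathAlgebra.ofPath K q}

/-- The commuting algebra `KQ/C`. -/
abbrev CommutingAlgebra : Type max u v w := (commutingIdeal K V).ringCon.Quotient

variable {V} in
/-- The image `ρ(p)` of a path `p` under the canonical surjection `ρ : KQ → KQ/C`. -/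
def CommutingAlgebra.ofPath {a b : V} (p : Path a b) : CommutingAlgebra K V :=
  (commutingIdeal K V).ringCon.mk' (PathAlgebra.ofPath K p)

end Commuting

section Components

variable (V : Type u) [Quiver.{v} V]

/-- Two vertices are path equivalent if there are paths between them in both directions. -/
def pathSetoid : Setoid V where
  r a b := Nonempty (Path a b) ∧ Nonempty (Path b a)
  iseqv :=
    { refl := fun _ => ⟨⟨Path.nil⟩, ⟨Path.nil⟩⟩
      symm := fun h => ⟨h.2, h.1⟩
      trans := fun ⟨⟨p⟩, ⟨p'⟩⟩ ⟨⟨q⟩, ⟨q'⟩⟩ => ⟨⟨p.comp q⟩, ⟨q'.comp p'⟩⟩ }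

/-- The set of path connected components of the quiver. It is the vertex set of the skeleton. -/
def PathComponent : Type u := Quotient (pathSetoid V)

variable {V}

/-- The path connected component of a vertex. -/
def PathComponent.mk (a : V) : PathComponent V := Quotient.mk (pathSetoid V) a

/-- `D ≤ E` if and only if there is a path from some vertex in `D` to some vertex in `E`. -/
instance : PartialOrder (PathComponent V) where
  le D E := ∃ a b : V, PathComponent.mk a = D ∧ PathComponent.mk b = E ∧ Nonempty (Path a b)
  le_refl D := by
    obtain ⟨a, rfl⟩ := Quotient.exists_rep D
    exact ⟨a, a, rfl, rfl, ⟨Path.nil⟩⟩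
  le_trans := by
    rintro D E F ⟨a, b, rfl, rfl, ⟨p⟩⟩ ⟨b', c, hb, rfl, ⟨q⟩⟩
    obtain ⟨-, ⟨r⟩⟩ := Quotient.exact hb
    exact ⟨a, c, rfl, rfl, ⟨(p.comp r).comp q⟩⟩
  le_antisymm := by
    rintro D E ⟨a, b, rfl, rfl, ⟨p⟩⟩ ⟨b', a', hb, ha, ⟨q⟩⟩
    obtain ⟨-, ⟨r⟩⟩ := Quotient.exact hb
    obtain ⟨⟨s⟩, -⟩ := Quotient.exact ha
    exact Quotient.sound ⟨⟨p⟩, ⟨(r.comp q).comp s⟩⟩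

theorem PathComponent.mk_le_mk (a b : V) :
    PathComponent.mk a ≤ PathComponent.mk b ↔ Nonempty (Path a b) := by
  constructor
  · rintro ⟨a', b', ha, hb, ⟨p⟩⟩
    obtain ⟨-, ⟨q⟩⟩ := Quotient.exact ha
    obtain ⟨⟨r⟩, -⟩ := Quotient.exact hb
    exact ⟨(q.comp p).comp r⟩
  · intro h
    exact ⟨a, b, rfl, rfl, h⟩

end Components

section Skeleton

variable (K : Type w) {V : Type u} [Field K] [Quiver.{v} V] [Fintype V]

/-- The right `KQ/C`-module `P`, the direct sum over all path connected components `D` of the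
right ideals `ρ(r D) (KQ/C)`, where `r D` is the vertex selected in `D`. (Right modules are modules
over the opposite ring. There are finitely many components, so the direct sum is the product.) -/
abbrev SkeletonModule (r : PathComponent V → V) : Type max u v w :=
  ∀ D : PathComponent V, Submodule.span (CommutingAlgebra K V)ᵐᵒᵖ
    {CommutingAlgebra.ofPath K (Path.nil : Path (r D) (r D))}

/-- The skeleton `Sk(Q) = End_{KQ/C}(P)`, formed with the selection `r` of vertices. -/
abbrev Skeleton (r : PathComponent V → V) : Type max u v w :=
  Module.End (CommutingAlgebra K V)ᵐᵒᵖ (SkeletonModule K r)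

end Skeleton

end Quiver

/-- The left global dimension of a ring: the supremum of the projective dimensions of its left
modules. -/
def leftGlobalDimension (R : Type u) [Ring R] : WithBot ℕ∞ :=
  ⨆ M : ModuleCat.{u} R, projectiveDimension M

/-- The right global dimension of a ring: the supremum of the projective dimensions of its right
modules. -/
def rightGlobalDimension (R : Type u) [Ring R] : WithBot ℕ∞ :=
  ⨆ M : ModuleCat.{u} Rᵐᵒᵖ, projectiveDimension M

/-- The length of the longest chain of a poset `S`, where a chain `s₁ < s₂ < ⋯ < sₜ` has
length `t`, the number of its elements. -/
def maxChainLength (S : Type u) [PartialOrder S] : ℕ∞ :=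
  (Set.univ : Set S).chainHeight (· < ·)

end

/-! In `KQ/C` all paths from `a` to `b` have one common image `e a b`, so each corner `e a a * R * e
b b` is at most a line. This gives finite dimension. Closed paths equal vertices, so `e a b` is
invertible inside a component, and between distinct components it vanishes unless the component
strictly rises. The skeleton has the same shape, with one vertex per component. `TriangularUnits`
records this shape, ordered by a rank below `t` that counts chains. For the global dimension, cover
`M` by the sum over blocks `i` of `R e_i ⊗ e_i M`, where `e_i` is the idempotent of the
representative. If `M` vanishes at ranks above `n`, triangularity makes the cover injective at ranks
at least `n`, so its kernel vanishes there (`e_smul_eq_zero_of_cover_eq_zero`). Induction on the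
rank ends at the zero module after at most `t` syzygies. Right modules follow because the structure
passes to the opposite ring. -/

noncomputable section

/-! ### Rank functions from chain heights -/

section ChainHeight

theorem Set.chainHeight_lt_add_one_le {S : Type*} [PartialOrder S] {s t : Set S} (hst : s ⊆ t)
    {y : S} (hy : y ∈ t) (hlt : ∀ x ∈ s, x < y) :
    s.chainHeight (· < ·) + 1 ≤ t.chainHeight (· < ·) := by
  rcases eq_or_ne (s.chainHeight (· < ·)) ⊤ with htop | htop
  · have := Set.chainHeight_mono (r := (· < ·)) s t hst
    rw [htop, top_le_iff] at this
    simp [this]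
  · obtain ⟨c, hcs, hc, hchain⟩ := s.exists_eq_chainHeight_of_chainHeight_ne_top _ htop
    rw [← hc, ← Set.encard_insert_of_notMem fun h => (hlt y (hcs h)).false]
    exact Set.encard_le_chainHeight_of_isChain _ _
      (Set.insert_subset hy (hcs.trans hst))
      (hchain.insert fun b hb _ => Or.inr (hlt b (hcs hb)))

/-- The rank of `i` is the length of the longest chain strictly below `i`; appending `i` to such a
chain gives both claims. -/
theorem exists_strictMono_lt_of_maxChainLength_eq {S : Type u} [PartialOrder S] {t : ℕ}
    (ht : maxChainLength S = t) :
    ∃ f : S → ℕ, StrictMono f ∧ ∀ i, f i < t := by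
  have key (i : S) : (Set.Iio i).chainHeight (· < ·) + 1 ≤ t :=
    ht ▸ Set.chainHeight_lt_add_one_le (Set.subset_univ _) (Set.mem_univ i) fun _ h => h
  have hne (i : S) : (Set.Iio i).chainHeight (· < ·) ≠ ⊤ := fun h => by
    have := key i
    simp [h] at this
  choose f hf using fun i => ENat.ne_top_iff_exists.mp (hne i)
  refine ⟨f, fun i j hij => ?_, fun i => ?_⟩
  · have := Set.chainHeight_lt_add_one_le (Set.Iio_subset_Iio hij.le) hij
      fun x (hx : x < i) => hx
    rw [← hf, ← hf] at this
    exact_mod_cast this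
  · have := key i
    rw [← hf] at this
    exact_mod_cast this

end ChainHeight

/-- A `K`-algebra `R` with elements `e a b` spanning the corners `e a a * R * e b b`, where the
indices are partitioned into blocks `i : ι` of rank less than `t`. The element `e a b` is invertible
inside a block, and vanishes between different blocks unless the rank increases. -/
structure TriangularUnits (K : Type*) (R : Type*) (V ι : Type*) [Field K] [Ring R] [Algebra K R]
    [Fintype V] (t : ℕ) where
  block : V → ι
  rep : ι → V
  block_rep : ∀ i, block (rep i) = i
  rank : ι → ℕ
  rank_lt : ∀ i, rank i < t
  e : V → V → R
  left_mul : ∀ a b, e a a * e a b = e a b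
  mul_right : ∀ a b, e a b * e b b = e a b
  mul_swap : ∀ a b, block a = block b → e a b * e b a = e a a
  eq_zero : ∀ a b, block a ≠ block b → ¬ rank (block a) < rank (block b) → e a b = 0
  sum_eq_one : ∑ a, e a a = 1
  corner : ∀ a b x, ∃ k : K, e a a * x * e b b = k • e a b

/-! ### Opposites and finite dimension -/

namespace TriangularUnits

variable {K : Type*} {R : Type*} {V ι : Type*} [Field K] [Ring R] [Algebra K R] [Fintype V] {t : ℕ}

/-- The opposite of a system of triangular units. -/
def op (E : TriangularUnits K R V ι t) : TriangularUnits K Rᵐᵒᵖ V ι t where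
  block := E.block
  rep := E.rep
  block_rep := E.block_rep
  -- Swapping the indices of `e` reverses the order of the blocks. Ranks are below `t`, so the
  -- truncated subtraction loses nothing.
  rank i := t - 1 - E.rank i
  rank_lt i := by have := E.rank_lt i; omega
  e a b := MulOpposite.op (E.e b a)
  left_mul a b := by rw [← MulOpposite.op_mul, E.mul_right]
  mul_right a b := by rw [← MulOpposite.op_mul, E.left_mul]
  mul_swap a b h := by rw [← MulOpposite.op_mul, E.mul_swap a b h]
  eq_zero a b h h' := by
    have := E.rank_lt (E.block a)
    have := E.rank_lt (E.block b)
    rw [E.eq_zero b a h.symm (by omega), MulOpposite.op_zero]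
  sum_eq_one := by 
    rw [← MulOpposite.op_one, ← E.sum_eq_one]
    exact (map_sum (MulOpposite.opAddEquiv : R ≃+ Rᵐᵒᵖ) _ _).symm
  corner a b x := by
    obtain ⟨k, hk⟩ := E.corner b a x.unop
    refine ⟨k, ?_⟩
    rw [← MulOpposite.op_smul, ← hk, mul_assoc]
    simp

/-- By the Peirce decomposition, the finitely many `e a b` span `R`. -/
theorem finite (E : TriangularUnits K R V ι t) : Module.Finite K R := by
  refine ⟨⟨(Set.finite_range fun p : V × V => E.e p.1 p.2).toFinset, ?_⟩⟩
  rw [Set.Finite.coe_toFinset, eq_top_iff]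
  intro x _
  have hx : x = ∑ a, ∑ b, E.e a a * x * E.e b b := by
    simp_rw [← Finset.mul_sum, ← Finset.sum_mul, E.sum_eq_one, one_mul, mul_one]
  rw [hx]
  refine Submodule.sum_mem _ fun a _ => Submodule.sum_mem _ fun b _ => ?_
  obtain ⟨k, hk⟩ := E.corner a b x
  rw [hk]
  exact Submodule.smul_mem _ _ (Submodule.subset_span ⟨(a, b), rfl⟩)

end TriangularUnits

/-! ### The projective cover and its kernel -/

section Cover

variable {K : Type*} {R : Type u} [Field K] [Ring R] [Algebra K R]

/-- Right multiplication by `e` retracts `R` onto the left ideal. -/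
theorem Module.Projective.span_singleton_of_isIdempotentElem {e : R} (he : e * e = e) :
    Module.Projective R (Submodule.span R {e}) := by
  refine Module.Projective.of_split (Submodule.span R {e}).subtype
    ((LinearMap.toSpanSingleton R R e).codRestrict _ fun x =>
      Submodule.smul_mem _ _ (Submodule.mem_span_singleton_self e)) ?_
  ext ⟨x, hx⟩
  obtain ⟨y, rfl⟩ := Submodule.mem_span_singleton.mp hx
  change y * e * e = y * e
  rw [mul_assoc, he]

variable {M : Type u} [AddCommGroup M] [Module R M] [Module K M] [IsScalarTower K R M]

open TensorProduct

/-- The multiplication map `I ⊗ N → M` for a left ideal `I` and a subspace `N` of `M`. -/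
def idealTensorMap (I : Submodule R R) (N : Submodule K M) : I ⊗[K] N →ₗ[R] M :=
  AlgebraTensorModule.lift
    { toFun x := Algebra.lsmul K K M x.1 ∘ₗ N.subtype
      map_add' x y := by ext; simp
      map_smul' x y := by ext; simp }

@[simp]
theorem idealTensorMap_tmul (I : Submodule R R) (N : Submodule K M) (x : I) (m : N) :
    idealTensorMap I N (x ⊗ₜ m) = (x : R) • (m : M) := rfl

end Cover

namespace TriangularUnits

variable {K : Type*} {R : Type u} {V ι : Type*} [Field K] [Ring R] [Algebra K R] [Fintype V] {t : ℕ}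
  (E : TriangularUnits K R V ι t)

section Cover

open TensorProduct

/-- The left ideal generated by the idempotent of the representative of a block. -/
abbrev leftIdeal (i : ι) : Submodule R R := Submodule.span R {E.e (E.rep i) (E.rep i)}

theorem e_rep_mem_leftIdeal (a : V) (i : ι) : E.e a (E.rep i) ∈ E.leftIdeal i :=
  Submodule.mem_span_singleton.mpr ⟨E.e a (E.rep i), E.mul_right _ _⟩

/-- The corner of the left ideal at `a` is spanned by a single element, and scalars move across the
tensor sign. -/
theorem exists_e_smul_eq_tmul (a : V) (i : ι) {N : Type*} [AddCommGroup N] [Module K N] (y : E.leftIdeal i ⊗[K] N) :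
    ∃ m : N, E.e a a • y = (⟨E.e a (E.rep i), E.e_rep_mem_leftIdeal a i⟩ : E.leftIdeal i) ⊗ₜ m := by
  induction y with
  | zero => exact ⟨0, by simp⟩
  | tmul x m =>
    obtain ⟨x, hx⟩ := x
    obtain ⟨y, rfl⟩ := Submodule.mem_span_singleton.mp hx
    obtain ⟨k, hk⟩ := E.corner a (E.rep i) y
    refine ⟨k • m, ?_⟩
    rw [TensorProduct.smul_tmul', ← TensorProduct.smul_tmul]
    congr 1
    ext
    simpa [mul_assoc] using hk
  | add y z hy hz =>
    obtain ⟨m, hm⟩ := hy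
    obtain ⟨m', hm'⟩ := hz
    exact ⟨m + m', by rw [smul_add, hm, hm', TensorProduct.tmul_add]⟩

variable (M : Type u) [AddCommGroup M] [Module R M] [Module K M] [IsScalarTower K R M]

/-- The component of the module `M` at the vertex `a`. -/
abbrev component (a : V) : Submodule K M :=
  LinearMap.range (Algebra.lsmul K K M (E.e a a))

variable {M} in
theorem e_smul_component {a : V} (m : E.component M a) : E.e a a • (m : M) = m := by
  obtain ⟨_, m, rfl⟩ := m
  simp [smul_smul, E.left_mul]

/-- The projective module covering `M`. -/
abbrev CoverModule : Type _ :=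
  Π₀ i : ι, E.leftIdeal i ⊗[K] E.component M (E.rep i)

open Classical in
/-- The cover of `M` by a projective module. -/
def cover : E.CoverModule M →ₗ[R] M :=
  DFinsupp.lsum ℕ fun i => idealTensorMap (E.leftIdeal i) (E.component M (E.rep i))

instance : Module.Projective R (E.CoverModule M) :=
  have (i : ι) : Module.Projective R (E.leftIdeal i) :=
    Module.Projective.span_singleton_of_isIdempotentElem (E.left_mul _ _)
  inferInstance

theorem cover_surjective : Function.Surjective (E.cover M) := by
  classical
  intro m
  rw [← LinearMap.mem_range, ← one_smul R m, ← E.sum_eq_one, Finset.sum_smul]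
  refine Submodule.sum_mem _ fun a _ => ?_
  set i := E.block a with hi
  have hb : E.block a = E.block (E.rep i) := by rw [E.block_rep]
  -- Inside a block, `e a a` factors through the representative as `e a (rep i) * e (rep i) a`.
  refine ⟨DFinsupp.single i (⟨E.e a (E.rep i), E.e_rep_mem_leftIdeal a i⟩ ⊗ₜ
    ⟨E.e (E.rep i) a • m, E.e (E.rep i) a • m, ?_⟩), ?_⟩
  · simp [smul_smul, E.left_mul]
  · simp [cover, smul_smul, E.mul_swap a _ hb]

variable {M}

/-- At a vertex `a` of rank at least `n`, only the summand of the block of `a` survives: for another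
block `i`, either its rank is larger and `e_i M = 0`, or `e a (rep i) = 0`. On the surviving summand
the cover is multiplication by an invertible unit, hence injective. -/
theorem e_smul_eq_zero_of_cover_eq_zero {n : ℕ}
    (hM : ∀ a, n + 1 ≤ E.rank (E.block a) → ∀ m : M, E.e a a • m = 0)
    {x : E.CoverModule M} (hx : E.cover M x = 0) {a : V} (ha : n ≤ E.rank (E.block a)) :
    E.e a a • x = 0 := by
  classical
  choose m hm using fun i => E.exists_e_smul_eq_tmul a i (x i)
  have hother (i : ι) (hi : i ≠ E.block a) : (E.e a a • x) i = 0 := by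
    rw [DFinsupp.smul_apply, hm]
    by_cases hlt : E.rank (E.block a) < E.rank i
    · have : m i = 0 := by
        ext
        rw [← E.e_smul_component (m i), hM _ (by rw [E.block_rep]; omega), Submodule.coe_zero]
      rw [this, TensorProduct.tmul_zero]
    · have h0 : E.e a (E.rep i) = 0 := E.eq_zero _ _ (by rw [E.block_rep]; exact hi.symm)
        (by rwa [E.block_rep])
      have : (⟨E.e a (E.rep i), E.e_rep_mem_leftIdeal a i⟩ : E.leftIdeal i) = 0 := Subtype.ext h0
      rw [this, TensorProduct.zero_tmul]
  have hsingle : E.e a a • x = DFinsupp.single (E.block a) ((E.e a a • x) (E.block a)) := by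
    ext1 i
    rcases eq_or_ne i (E.block a) with rfl | hi
    · simp
    · rw [hother i hi, DFinsupp.single_eq_of_ne hi]
  have hzero : E.e a (E.rep (E.block a)) • (m (E.block a) : M) = 0 := by
    have h := congrArg (E.cover M) hsingle
    rw [map_smul, hx, smul_zero, DFinsupp.smul_apply, hm] at h
    simpa [cover] using h.symm
  -- Multiplying by `e (rep i) a` undoes the action of `e a (rep i)`, where `i` is the block of `a`.
  have hm0 : m (E.block a) = 0 := by
    ext
    rw [← E.e_smul_component (m (E.block a)),
      ← E.mul_swap (E.rep (E.block a)) a (by rw [E.block_rep]), mul_smul, hzero, smul_zero,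
      Submodule.coe_zero]
  rw [hsingle, DFinsupp.smul_apply, hm, hm0, TensorProduct.tmul_zero, DFinsupp.single_zero]

end Cover

end TriangularUnits

/-! ### Dimension shifting and the global dimension bound -/

theorem ModuleCat.hasProjectiveDimensionLT_of_surjective {R : Type u} [Ring R] {F M : Type u}
    [AddCommGroup F] [AddCommGroup M] [Module R F] [Module R M] [Module.Projective R F]
    {f : F →ₗ[R] M} (hf : Function.Surjective f) {n : ℕ}
    (h : HasProjectiveDimensionLT (ModuleCat.of R (LinearMap.ker f)) n) :
    HasProjectiveDimensionLT (ModuleCat.of R M) (n + 1) := by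
  have hex := f.exact_subtype_ker_map
  have hS := ModuleCat.shortComplex_shortExact
    (ModuleCat.shortComplexOfCompEqZero _ _ hex.linearMap_comp_eq_zero) hex
    (Submodule.injective_subtype _) hf
  have : Projective (ModuleCat.of R F) := (IsProjective.iff_projective F).mp inferInstance
  exact hS.hasProjectiveDimensionLT_X₃ n h
    (inferInstanceAs (HasProjectiveDimensionLT (ModuleCat.of R F) (n + 1)))

namespace TriangularUnits

variable {K : Type*} {V : Type*} {ι : Type v} {R : Type max u v} [Field K] [Ring R] [Algebra K R]
  [Fintype V] {t : ℕ}

/-- Each syzygy lowers by one the rank from which the module vanishes; vanishing from rank `0` on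
means being zero, since the `e a a` sum to `1`. -/
theorem hasProjectiveDimensionLT (E : TriangularUnits K R V ι t) (n : ℕ)
    (M : Type max u v) [AddCommGroup M] [Module R M]
    (hM : ∀ a, n ≤ E.rank (E.block a) → ∀ m : M, E.e a a • m = 0) :
    HasProjectiveDimensionLT (ModuleCat.of R M) n := by
  induction n generalizing M with
  | zero =>
    rw [hasProjectiveDimensionLT_zero_iff_isZero]
    have : Subsingleton M := subsingleton_of_forall_eq 0 fun m => by
      rw [← one_smul R m, ← E.sum_eq_one, Finset.sum_smul]
      exact Finset.sum_eq_zero fun a _ => hM a (Nat.zero_le _) m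
    exact ModuleCat.isZero_of_subsingleton _
  | succ n ih =>
    let : Module K M := Module.compHom M (algebraMap K R)
    have : IsScalarTower K R M := ⟨fun k x m => by
      rw [Algebra.smul_def, mul_smul]; rfl⟩
    refine ModuleCat.hasProjectiveDimensionLT_of_surjective
      (F := E.CoverModule M) (f := E.cover M) (E.cover_surjective M) (ih _ ?_)
    rintro a ha ⟨x, hx⟩
    exact Subtype.ext (E.e_smul_eq_zero_of_cover_eq_zero hM hx ha)

theorem leftGlobalDimension_le (E : TriangularUnits K R V ι t) : leftGlobalDimension R ≤ t := by
  -- No rank reaches `t`, so the vanishing hypothesis is void; each module even has projective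
  -- dimension below `t`.
  refine iSup_le fun M => ((projectiveDimension_lt_iff (n := t)).mpr ?_).le
  refine E.hasProjectiveDimensionLT t M fun a ha => ?_
  exact absurd (E.rank_lt (E.block a)) ha.not_gt

theorem rightGlobalDimension_le (E : TriangularUnits K R V ι t) : rightGlobalDimension R ≤ t :=
  E.op.leftGlobalDimension_le

end TriangularUnits

/-! ### Triangular units in the commuting algebra -/

namespace Quiver

namespace CommutingAlgebra

variable (K : Type w) {V : Type u} [Field K] [Quiver.{v} V] [Fintype V]

theorem ofPath_eq {a b : V} (p q : Path a b) : ofPath K p = ofPath K q := by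
  refine (RingCon.eq _).mpr ?_
  rw [TwoSidedIdeal.rel_iff]
  exact TwoSidedIdeal.subset_span ⟨a, b, p, q, rfl⟩

theorem ofPath_mul {a b c : V} (p : Path a b) (q : Path b c) :
    ofPath K p * ofPath K q = ofPath K (p.comp q) := by
  rw [ofPath, ofPath, ← map_mul, PathAlgebra.ofPath_mul]; rfl

theorem ofPath_mul_of_ne {a b b' c : V} (h : b ≠ b') (p : Path a b) (q : Path b' c) :
    ofPath K p * ofPath K q = 0 := by
  rw [ofPath, ofPath, ← map_mul, PathAlgebra.ofPath_mul_of_ne K h, map_zero]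

theorem sum_ofPath_nil : ∑ a : V, ofPath K (Path.nil : Path a a) = 1 := by
  simp_rw [ofPath, ← map_sum, ← PathAlgebra.one_def, map_one]

variable {K} in
theorem induction {P : CommutingAlgebra K V → Prop} (x : CommutingAlgebra K V) (zero : P 0)
    (add : ∀ x y, P x → P y → P (x + y))
    (smul_ofPath : ∀ (k : K) (a b : V) (p : Path a b), P (k • ofPath K p)) : P x := by
  obtain ⟨x, rfl⟩ := RingCon.mk'_surjective _ x
  induction x using Finsupp.induction_linear with
  | zero => exact zero
  | add x y hx hy => exact add _ _ hx hy
  | single p k =>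
    obtain ⟨a, b, p⟩ := p
    have h : (Finsupp.single ⟨a, b, p⟩ k : AllPaths V →₀ K) = k • Finsupp.single ⟨a, b, p⟩ 1 := by
      simp
    rw [h]
    exact smul_ofPath k a b p

open Classical in
/-- The common image of all the paths from `a` to `b`, or `0` if there is none. -/
def unit (a b : V) : CommutingAlgebra K V :=
  if h : Nonempty (Path a b) then ofPath K h.some else 0

theorem unit_eq_ofPath {a b : V} (p : Path a b) : unit K a b = ofPath K p := by
  rw [unit, dif_pos ⟨p⟩, ofPath_eq K _ p]

theorem unit_eq_zero {a b : V} (h : ¬ Nonempty (Path a b)) : unit K a b = 0 := dif_neg h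

theorem unit_mul_unit {a b c : V} (h : Nonempty (Path a b)) (h' : Nonempty (Path b c)) :
    unit K a b * unit K b c = unit K a c := by
  obtain ⟨p⟩ := h
  obtain ⟨q⟩ := h'
  rw [unit_eq_ofPath K p, unit_eq_ofPath K q, ofPath_mul, unit_eq_ofPath K]

theorem unit_self_mul (a b : V) : unit K a a * unit K a b = unit K a b := by
  by_cases h : Nonempty (Path a b)
  · exact unit_mul_unit K ⟨Path.nil⟩ h
  · rw [unit_eq_zero K h, mul_zero]

theorem mul_unit_self (a b : V) : unit K a b * unit K b b = unit K a b := by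
  by_cases h : Nonempty (Path a b)
  · exact unit_mul_unit K h ⟨Path.nil⟩
  · rw [unit_eq_zero K h, zero_mul]

variable {K} in
-- By linearity `x` may be a multiple of a path; it is killed unless the path runs from `a` to `b`,
-- and all such paths agree.
theorem exists_unit_mul_mul_unit_eq (a b : V) (x : CommutingAlgebra K V) :
    ∃ k : K, unit K a a * x * unit K b b = k • unit K a b := by
  induction x using induction with
  | zero => exact ⟨0, by simp⟩
  | add x y hx hy =>
    obtain ⟨k, hk⟩ := hx
    obtain ⟨l, hl⟩ := hy
    exact ⟨k + l, by rw [mul_add, add_mul, hk, hl, add_smul]⟩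
  | smul_ofPath k c d p =>
    rw [unit_eq_ofPath K (Path.nil : Path a a), unit_eq_ofPath K (Path.nil : Path b b)]
    by_cases hc : a = c
    · subst hc
      by_cases hd : d = b
      · subst hd
        refine ⟨k, ?_⟩
        rw [mul_smul_comm, smul_mul_assoc, ofPath_mul, ofPath_mul, unit_eq_ofPath K]
      · exact ⟨0, by rw [mul_assoc, smul_mul_assoc, ofPath_mul_of_ne K hd]; simp⟩
    · exact ⟨0, by rw [mul_smul_comm, ofPath_mul_of_ne K hc]; simp⟩

/-- The images of the paths form a system of triangular units in the commuting algebra, with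
respect to any strictly monotone rank function on the path connected components. -/
def triangularUnits (r : PathComponent V → V) (hr : ∀ D, PathComponent.mk (r D) = D) {t : ℕ}
    {f : PathComponent V → ℕ} (hf : StrictMono f) (hft : ∀ D, f D < t) :
    TriangularUnits K (CommutingAlgebra K V) V (PathComponent V) t where
  block := PathComponent.mk
  rep := r
  block_rep := hr
  rank := f
  rank_lt := hft
  e := unit K
  left_mul := unit_self_mul K
  mul_right := mul_unit_self K
  mul_swap a b h :=
    unit_mul_unit K ((PathComponent.mk_le_mk a b).mp h.le) ((PathComponent.mk_le_mk b a).mp h.ge)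
  eq_zero a b h h' := unit_eq_zero K fun hp =>
    h' (hf (((PathComponent.mk_le_mk a b).mpr hp).lt_of_ne h))
  sum_eq_one := by
    rw [← sum_ofPath_nil]
    exact Finset.sum_congr rfl fun a _ => unit_eq_ofPath K _
  corner := exists_unit_mul_mul_unit_eq

end CommutingAlgebra

/-! ### Triangular units in the skeleton -/

namespace Skeleton

open CommutingAlgebra

variable (K : Type w) {V : Type u} [Field K] [Quiver.{v} V] [Fintype V] (r : PathComponent V → V)

instance : Finite (PathComponent V) := inferInstanceAs (Finite (Quotient (pathSetoid V)))

/-- The right ideal of the commuting algebra generated by a vertex. -/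
abbrev rightIdeal (a : V) : Submodule (CommutingAlgebra K V)ᵐᵒᵖ (CommutingAlgebra K V) :=
  Submodule.span (CommutingAlgebra K V)ᵐᵒᵖ {CommutingAlgebra.ofPath K (Path.nil : Path a a)}

variable {K} in
theorem mem_rightIdeal {a : V} {x : CommutingAlgebra K V} :
    x ∈ rightIdeal K a ↔ unit K a a * x = x := by
  rw [unit_eq_ofPath K Path.nil]
  constructor
  · intro h
    obtain ⟨y, rfl⟩ := Submodule.mem_span_singleton.mp h
    obtain ⟨y, rfl⟩ := MulOpposite.op_surjective y
    rw [op_smul_eq_mul, ← mul_assoc, ofPath_mul, Path.comp_nil]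
  · intro h
    exact Submodule.mem_span_singleton.mpr ⟨MulOpposite.op x, h⟩

theorem unit_mem_rightIdeal (a b : V) : unit K a b ∈ rightIdeal K a :=
  mem_rightIdeal.mpr (unit_self_mul K a b)

/-- Left multiplication by `unit K a b`, as a map between right ideals. -/
def mulUnit (a b : V) : rightIdeal K b →ₗ[(CommutingAlgebra K V)ᵐᵒᵖ] rightIdeal K a :=
  (DistribSMul.toLinearMap (CommutingAlgebra K V)ᵐᵒᵖ (CommutingAlgebra K V)
    (unit K a b)).restrict fun x _ => mem_rightIdeal.mpr (by
      rw [DistribSMul.toLinearMap_apply, smul_eq_mul, ← mul_assoc, unit_self_mul])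

@[simp]
theorem coe_mulUnit (a b : V) (x : rightIdeal K b) :
    (mulUnit K a b x : CommutingAlgebra K V) = unit K a b * x := rfl

open Classical in
/-- The endomorphism of the skeleton module given by left multiplication by
`unit K (r D) (r D')`. -/
def unit (D D' : PathComponent V) : Skeleton K r :=
  LinearMap.single _ _ D ∘ₗ mulUnit K (r D) (r D') ∘ₗ LinearMap.proj D'

variable {K r}

theorem unit_apply_self (D D' : PathComponent V) (x : SkeletonModule K r) :
    (unit K r D D' x D : CommutingAlgebra K V) =
      CommutingAlgebra.unit K (r D) (r D') * x D' := by
  simp [unit]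

theorem unit_apply_of_ne {D D' E : PathComponent V} (h : E ≠ D) (x : SkeletonModule K r) :
    unit K r D D' x E = 0 := by
  simp [unit, h]

theorem hom_ext {D : PathComponent V} {f g : Skeleton K r}
    (h : ∀ x, (f x D : CommutingAlgebra K V) = g x D)
    (hf : ∀ x E, E ≠ D → f x E = 0) (hg : ∀ x E, E ≠ D → g x E = 0) : f = g := by
  ext1 x
  funext E
  rcases eq_or_ne E D with rfl | hE
  · exact Subtype.ext (h x)
  · rw [hf x E hE, hg x E hE]

theorem unit_mul_unit {D D' D'' : PathComponent V}
    (h : CommutingAlgebra.unit K (r D) (r D') * CommutingAlgebra.unit K (r D') (r D'') =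
      CommutingAlgebra.unit K (r D) (r D'')) :
    unit K r D D' * unit K r D' D'' = unit K r D D'' := by
  refine hom_ext (D := D) (fun x => ?_) (fun x E hE => unit_apply_of_ne hE _)
    (fun x E hE => unit_apply_of_ne hE _)
  rw [Module.End.mul_apply, unit_apply_self, unit_apply_self, unit_apply_self, ← mul_assoc, h]

theorem unit_eq_zero {D D' : PathComponent V}
    (h : CommutingAlgebra.unit K (r D) (r D') = 0) : unit K r D D' = 0 := by
  refine hom_ext (D := D) (fun x => ?_) (fun x E hE => unit_apply_of_ne hE _) (fun x E hE => rfl)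
  rw [unit_apply_self, h, zero_mul]
  rfl

/-- A map out of a right ideal generated by an idempotent is determined by the image of that
idempotent. Here the relevant component of the image lies in a corner of `KQ/C`, which is at most a
line. -/
theorem exists_unit_mul_mul_unit_eq (D D' : PathComponent V) (f : Skeleton K r) :
    ∃ k : K, unit K r D D * f * unit K r D' D' = k • unit K r D D' := by
  classical
  set g : rightIdeal K (r D') := ⟨_, unit_mem_rightIdeal K (r D') (r D')⟩ with hg
  set z := f (Pi.single D' g) with hz
  -- The generator is fixed by its idempotent, so its image under `f` is too; this puts `z D` in the
  -- corner.
  have hgg : MulOpposite.op (CommutingAlgebra.unit K (r D') (r D')) • g = g :=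
    Subtype.ext (unit_self_mul K _ _)
  have hzz : (z D : CommutingAlgebra K V) * CommutingAlgebra.unit K (r D') (r D') = z D := by
    conv_rhs => rw [hz, ← hgg, Pi.single_smul, map_smul, ← hz]
    rfl
  obtain ⟨k, hk⟩ := CommutingAlgebra.exists_unit_mul_mul_unit_eq (r D) (r D')
    (z D : CommutingAlgebra K V)
  rw [mem_rightIdeal.mp (z D).2, hzz] at hk
  refine ⟨k, hom_ext (D := D) (fun x => ?_) (fun x E hE => unit_apply_of_ne hE _)
    (fun x E hE => ?_)⟩
  · have hx : unit K r D' D' x = MulOpposite.op (x D' : CommutingAlgebra K V) • Pi.single D' g := by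
      funext E
      rcases eq_or_ne E D' with rfl | hE
      · apply Subtype.ext
        rw [unit_apply_self]
        simp [hg]
      · rw [unit_apply_of_ne hE]
        simp [hE]
    rw [Module.End.mul_apply, Module.End.mul_apply, unit_apply_self, hx, map_smul, ← hz,
      mem_rightIdeal.mp (Subtype.mem _)]
    change (z D : CommutingAlgebra K V) * x D' =
      k • (unit K r D D' x D : CommutingAlgebra K V)
    rw [hk, unit_apply_self, smul_mul_assoc]
  · rw [LinearMap.smul_apply, Pi.smul_apply, unit_apply_of_ne hE, smul_zero]

theorem sum_unit_self [Fintype (PathComponent V)] : ∑ D, unit K r D D = 1 := by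
  ext1 x
  funext E
  rw [LinearMap.sum_apply, Finset.sum_apply, Finset.sum_eq_single E]
  · exact Subtype.ext (by rw [unit_apply_self, mem_rightIdeal.mp (x E).2]; rfl)
  · intro D _ hD
    exact unit_apply_of_ne hD.symm _
  · simp

variable (K) in
/-- The units `unit K r D D'` form a system of triangular units in the skeleton. -/
def triangularUnits [Fintype (PathComponent V)] (hr : ∀ D, PathComponent.mk (r D) = D) {t : ℕ}
    {f : PathComponent V → ℕ} (hf : StrictMono f) (hft : ∀ D, f D < t) :
    TriangularUnits K (Skeleton K r) (PathComponent V) (PathComponent V) t where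
  -- Each block is a single index, since a component has only one chosen vertex.
  block := id
  rep := id
  block_rep _ := rfl
  rank := f
  rank_lt := hft
  e := unit K r
  left_mul _ _ := unit_mul_unit (unit_self_mul K _ _)
  mul_right _ _ := unit_mul_unit (mul_unit_self K _ _)
  mul_swap := by
    rintro D _ rfl
    exact unit_mul_unit (unit_self_mul K _ _)
  eq_zero D D' h h' := by
    refine unit_eq_zero (CommutingAlgebra.unit_eq_zero K fun hp => h' (hf (lt_of_le_of_ne ?_ h)))
    rw [← PathComponent.mk_le_mk, hr, hr] at hp
    exact hp
  sum_eq_one := sum_unit_self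
  corner := exists_unit_mul_mul_unit_eq

end Skeleton

end Quiver

end

theorem theorem6p5 {K : Type w} {V : Type u} [Field K] [Quiver.{v} V]
    [Fintype V] [∀ a b : V, Finite (a ⟶ b)]
    (r : Quiver.PathComponent V → V)
    (hr : ∀ D : Quiver.PathComponent V, Quiver.PathComponent.mk (r D) = D) :
    Module.Finite K (Quiver.CommutingAlgebra K V) ∧
    Module.Finite K (Quiver.Skeleton K r) ∧
    ∃ t : ℕ, maxChainLength (Quiver.PathComponent V) = t ∧
      rightGlobalDimension (Quiver.CommutingAlgebra K V) ≤ t ∧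
      leftGlobalDimension (Quiver.CommutingAlgebra K V) ≤ t ∧
      rightGlobalDimension (Quiver.Skeleton K r) ≤ t ∧
      leftGlobalDimension (Quiver.Skeleton K r) ≤ t := by
  have : Fintype (Quiver.PathComponent V) := Fintype.ofFinite _
  obtain ⟨t, ht⟩ := ENat.ne_top_iff_exists.mp
    (Set.chainHeight_ne_top_of_finite _ (· < ·) (Set.finite_univ (α := Quiver.PathComponent V)))
  obtain ⟨f, hf, hft⟩ := exists_strictMono_lt_of_maxChainLength_eq ht.symm
  let E := Quiver.CommutingAlgebra.triangularUnits K r hr hf hft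
  let E' := Quiver.Skeleton.triangularUnits K hr hf hft
  exact ⟨E.finite, E'.finite, t, ht.symm,
    TriangularUnits.rightGlobalDimension_le.{max v w, u} E,
    TriangularUnits.leftGlobalDimension_le.{max v w, u} E,
    TriangularUnits.rightGlobalDimension_le.{max v w, u} E',
    TriangularUnits.leftGlobalDimension_le.{max v w, u} E'⟩
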